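/- Let $A,B,\alpha,\beta,\gamma\ge 0$ be real numbers with $A\beta+B\alpha+\gamma>0$, and let $\{f_{m,n}\}_{m,n\ge 0}$ be defined by \[ f_{m,n}=\begin{cases}A^mB^n, & \text{if } mn=0,\\ \alpha f_{m-1,n}+\beta f_{m,n-1}+\gamma f_{m-1,n-1}, & \text{if } mn>0,\end{cases} \] with the convention $0^0=1$. Put $T=\alpha\beta+\sqrt{\alpha\beta(\alpha\beta+\gamma)}$. Then $f_{m,m}\neq 0$ for every $m\ge 0$, and the limit \[ \mathfrak{L}=\lim_{m\to\infty}\frac{f_{m+1,m+1}}{f_{m,m}} \] exists (and is finite). If neither $A=\alpha=0$ nor $B=\beta=0$, its value is \[ \mathfrak{L}=\begin{cases} \left(\sqrt{\alpha\beta}+\sqrt{\alpha\beta+\gamma}\right)^2, & \text{if } A\beta<T \text{ and } B\alpha<T,\\ B\left(\frac{\alpha B+\gamma}{B-\beta}\right), & \text{if } A\beta\le T\le B\alpha,\\ B\left(\frac{\alpha B+\gamma}{B-\beta}\right), & \text{if } T\le A\beta<B\alpha,\\ A\left(\frac{A\beta+\gamma}{A-\alpha}\right), & \text{if } B\alpha\le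 T\le A\beta,\\ A\left(\frac{A\beta+\gamma}{A-\alpha}\right), & \text{if } T\le B\alpha<A\beta,\\ B\left(\frac{\alpha B+\gamma}{B-\beta}\right), & \text{if } T<A\beta=B\alpha, \end{cases} \] where the denominator displayed in each case is nonzero whenever that case applies (cases that overlap give the same value). In the remaining degenerate situation, that is, if $A=\alpha=0$ or $B=\beta=0$, one has $\mathfrak{L}=\gamma$. -/

import Mathlib

open Filter Topology

/-- The bivariate sequence `f_{m,n}` with `f_{m,n} = A^m B^n` if `m n = 0` and
`f_{m,n} = α f_{m-1,n} + β f_{m,n-1} + γ f_{m-1,n-1}` if `m n > 0`. -/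
noncomputable def delannoyF (A B α β γ : ℝ) : ℕ → ℕ → ℝ
  | 0, n => A ^ 0 * B ^ n
  | m + 1, 0 => A ^ (m + 1) * B ^ 0
  | m + 1, n + 1 =>
      α * delannoyF A B α β γ m (n + 1) + β * delannoyF A B α β γ (m + 1) n
        + γ * delannoyF A B α β γ m n
  termination_by m n => m + n

/-- The initial conditions. -/
theorem delannoyF_of_mul_eq_zero (A B α β γ : ℝ) {m n : ℕ} (h : m * n = 0) :
    delannoyF A B α β γ m n = A ^ m * B ^ n := by
  rcases m with _ | m
  · rw [delannoyF]
  · rcases n with _ | n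
    · rw [delannoyF]
    · simp at h

/-- The recurrence. -/
theorem delannoyF_of_mul_pos (A B α β γ : ℝ) {m n : ℕ} (h : 0 < m * n) :
    delannoyF A B α β γ m n
      = α * delannoyF A B α β γ (m - 1) n + β * delannoyF A B α β γ m (n - 1)
        + γ * delannoyF A B α β γ (m - 1) (n - 1) := by
  rcases m with _ | m
  · simp at h
  · rcases n with _ | n
    · simp at h
    · rw [delannoyF]; rfl

/-- The threshold `αβ + √(αβ(αβ+γ))`. -/
noncomputable def delannoyThreshold (α β γ : ℝ) : ℝ :=
  α * β + Real.sqrt (α * β * (α * β + γ))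

/-! Let `α, β > 0`. The recurrence is linear, so on the diagonal `f = S_A + S_B - D`. Here `D` has
axis values `α ^ m`, `β ^ n` and generating function `F = 1 / (1 - αx - βy - γxy)`, while `S_A`
(resp. `S_B`) has one of these axes replaced by powers of `A` (resp. `B`). A differential equation
for `F` gives `D_{m+1,m+1} / D_{m,m} → 2T + γ` (`tendsto_offdiag_div_diag`, `tendsto_diag_ratio`).
On the diagonal `S_A(m+1) = r S_A(m) + k_m D_m` with `r = A(Aβ+γ)/(A-α)`, and `r - (2T+γ)` is a
square divided by `β(A-α)`, vanishing only at `Aβ = T` (for `A > α`). If `Aβ ≥ T`, the forcing is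
negligible and `S_A` grows at rate `r` (`tendsto_ratio_of_le`). If `Aβ < T`, `S_A / D` converges
(`tendsto_div_diag_of_lt`). The dominant summand thus decides the limit: `D` when both sides are
subcritical, otherwise the side with the larger of `Aβ`, `Bα`. It remains to see that the leading
coefficient of `f` does not vanish. If `α = 0` or `β = 0`, the diagonal is an explicit geometric
sequence. -/

/-! ### Symmetry, positivity and monotonicity -/

theorem delannoyF_zero_left (A B α β γ : ℝ) (n : ℕ) : delannoyF A B α β γ 0 n = B ^ n := by
  rw [delannoyF_of_mul_eq_zero _ _ _ _ _ (by simp)]; simp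

theorem delannoyF_zero_right (A B α β γ : ℝ) (m : ℕ) : delannoyF A B α β γ m 0 = A ^ m := by
  rw [delannoyF_of_mul_eq_zero _ _ _ _ _ (by simp)]; simp

theorem delannoyF_succ_succ (A B α β γ : ℝ) (m n : ℕ) :
    delannoyF A B α β γ (m + 1) (n + 1) = α * delannoyF A B α β γ m (n + 1)
      + β * delannoyF A B α β γ (m + 1) n + γ * delannoyF A B α β γ m n := by
  rw [delannoyF_of_mul_pos _ _ _ _ _ (by positivity)]; rfl

theorem delannoyF_swap (A B α β γ : ℝ) (m n : ℕ) :
    delannoyF A B α β γ m n = delannoyF B A β α γ n m := by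
  induction n generalizing m with
  | zero => rw [delannoyF_zero_right, delannoyF_zero_left]
  | succ n ihn =>
    induction m with
    | zero => rw [delannoyF_zero_right, delannoyF_zero_left]
    | succ m ihm => rw [delannoyF_succ_succ, delannoyF_succ_succ, ihm, ihn, ihn]; ring

theorem delannoyF_nonneg {A B α β γ : ℝ} (hA : 0 ≤ A) (hB : 0 ≤ B) (hα : 0 ≤ α) (hβ : 0 ≤ β)
    (hγ : 0 ≤ γ) (m n : ℕ) : 0 ≤ delannoyF A B α β γ m n := by
  induction n generalizing m with
  | zero => rw [delannoyF_zero_right]; positivity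
  | succ n ihn =>
    induction m with
    | zero => rw [delannoyF_zero_left]; positivity
    | succ m ihm =>
      rw [delannoyF_succ_succ]
      have h1 := ihn m
      have h2 := ihn (m + 1)
      positivity

theorem delannoyF_mono_left {A A' B α β γ : ℝ} (hA : 0 ≤ A) (hAA' : A ≤ A') (hα : 0 ≤ α)
    (hβ : 0 ≤ β) (hγ : 0 ≤ γ) (m n : ℕ) :
    delannoyF A B α β γ m n ≤ delannoyF A' B α β γ m n := by
  induction n generalizing m with
  | zero => rw [delannoyF_zero_right, delannoyF_zero_right]; gcongr
  | succ n ihn =>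
    induction m with
    | zero => rw [delannoyF_zero_left, delannoyF_zero_left]
    | succ m ihm =>
      rw [delannoyF_succ_succ, delannoyF_succ_succ]
      have h1 := ihn m
      have h2 := ihn (m + 1)
      gcongr

theorem delannoyF_succ_pos_of_left {A B α β γ : ℝ} (hA : 0 < A) (hB : 0 ≤ B) (hα : 0 ≤ α)
    (hβ : 0 < β) (hγ : 0 ≤ γ) (m n : ℕ) : 0 < delannoyF A B α β γ (m + 1) n := by
  induction n with
  | zero => rw [delannoyF_zero_right]; positivity
  | succ n ih =>
    rw [delannoyF_succ_succ]
    have h1 := delannoyF_nonneg hA.le hB hα hβ.le hγ m (n + 1)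
    have h2 := delannoyF_nonneg hA.le hB hα hβ.le hγ m n
    positivity

/-! ### Reduction to one-sided initial data -/

/-- The initial values on the two axes may be varied separately. -/
theorem delannoyF_superposition (A B α β γ : ℝ) (m n : ℕ) :
    delannoyF A B α β γ m n = delannoyF A β α β γ m n + delannoyF α B α β γ m n
      - delannoyF α β α β γ m n := by
  induction n generalizing m with
  | zero => simp only [delannoyF_zero_right]; ring
  | succ n ihn =>
    induction m with
    | zero => simp only [delannoyF_zero_left]; ring
    | succ m ihm => simp only [delannoyF_succ_succ, ihm, ihn]; ring

/-- Coefficient form of `(1 - Ax) G = (1 - αx) F`, where `G` is the generating function with axis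
values `A ^ m`, `β ^ n`. -/
theorem delannoyF_succ_left (A α β γ : ℝ) (m n : ℕ) :
    delannoyF A β α β γ (m + 1) n = A * delannoyF A β α β γ m n
      + delannoyF α β α β γ (m + 1) n - α * delannoyF α β α β γ m n := by
  induction n generalizing m with
  | zero => simp only [delannoyF_zero_right]; ring
  | succ n ihn =>
    induction m with
    | zero =>
      have := ihn 0
      simp only [delannoyF_succ_succ, delannoyF_zero_left] at this ⊢
      linear_combination β * this
    | succ m ihm =>
      have h1 := ihn m
      have h2 := ihn (m + 1)
      have e1 := delannoyF_succ_succ A β α β γ (m + 1) n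
      have e2 := delannoyF_succ_succ α β α β γ (m + 1) n
      have e3 := delannoyF_succ_succ A β α β γ m n
      have e4 := delannoyF_succ_succ α β α β γ m n
      linear_combination α * ihm + β * h2 + γ * h1 + e1 - e2 - A * e3 + α * e4

/-- Eliminating the neighbouring values of the `A`-array between its recurrence and
`delannoyF_succ_left` leaves a first-order recurrence along diagonals, forced by `D`. -/
theorem delannoyF_diag_step (A α β γ : ℝ) (m n : ℕ) :
    (A - α) * delannoyF A β α β γ (m + 1) (n + 1)
      = A * (A * β + γ) * delannoyF A β α β γ m n
        + (A - α) * (β * delannoyF α β α β γ (m + 1) n)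
        - α * (A * β + γ) * delannoyF α β α β γ m n := by
  have h1 := delannoyF_succ_left A α β γ m n
  have h2 := delannoyF_succ_left A α β γ m (n + 1)
  have e1 := delannoyF_succ_succ A β α β γ m n
  have e2 := delannoyF_succ_succ α β α β γ m n
  linear_combination A * e1 - α * h2 - α * e2 + A * β * h1

theorem delannoyF_eq_sum (A α β γ : ℝ) (m n : ℕ) :
    delannoyF A β α β γ m n = delannoyF α β α β γ m n
      + (A - α) * ∑ j ∈ Finset.range m, A ^ j * delannoyF α β α β γ (m - 1 - j) n := by
  induction m with
  | zero => simp [delannoyF_zero_left]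
  | succ m ih =>
    rw [delannoyF_succ_left, Finset.sum_range_succ']
    have : ∑ j ∈ Finset.range m, A ^ (j + 1) * delannoyF α β α β γ (m + 1 - 1 - (j + 1)) n
        = A * ∑ j ∈ Finset.range m, A ^ j * delannoyF α β α β γ (m - 1 - j) n := by
      rw [Finset.mul_sum]
      refine Finset.sum_congr rfl fun j _ => ?_
      rw [show m + 1 - 1 - (j + 1) = m - 1 - j by omega]; ring
    rw [this]
    simp only [pow_zero, one_mul, Nat.add_sub_cancel, Nat.sub_zero]
    linear_combination A * ih

/-! ### Diagonal asymptotics of the kernel `D` -/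

/-- Both sides of `(β + γx) F_x = (α + γy) F_y` equal `(α + γy)(β + γx) F²`; this compares
coefficients of `x ^ m y ^ n`. -/
theorem delannoyF_holonomic (α β γ : ℝ) (m n : ℕ) :
    β * (m + 1) * delannoyF α β α β γ (m + 1) n + γ * (m - n) * delannoyF α β α β γ m n
      = α * (n + 1) * delannoyF α β α β γ m (n + 1) := by
  induction n generalizing m with
  | zero =>
    induction m with
    | zero => simp [delannoyF_zero_left, delannoyF_zero_right, mul_comm]
    | succ m ihm =>
      have e := delannoyF_succ_succ α β α β γ m 0
      simp only [delannoyF_zero_right] at ihm e ⊢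
      push_cast at ihm ⊢
      linear_combination α * ihm - α * e
  | succ n ihn =>
    induction m with
    | zero =>
      have h := ihn 0
      have e := delannoyF_succ_succ α β α β γ 0 n
      simp only [delannoyF_zero_left] at h e ⊢
      push_cast at h ⊢
      linear_combination β * h + β * e
    | succ m ihm =>
      have h1 := ihn m
      have h2 := ihn (m + 1)
      have e1 := delannoyF_succ_succ α β α β γ (m + 1) n
      have e2 := delannoyF_succ_succ α β α β γ m (n + 1)
      have e3 := delannoyF_succ_succ α β α β γ m n
      push_cast at *
      linear_combination β * (m + 2) * e1 - α * (n + 2) * e2 + γ * (m - n) * e3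
        + α * ihm + β * h2 + γ * h1

theorem delannoyF_diag_symm (α β γ : ℝ) (m : ℕ) :
    β * delannoyF α β α β γ (m + 1) m = α * delannoyF α β α β γ m (m + 1) := by
  have h := delannoyF_holonomic α β γ m m
  have hm : (m : ℝ) + 1 ≠ 0 := by positivity
  apply mul_left_cancel₀ hm
  linear_combination h

theorem delannoyF_diag_succ (α β γ : ℝ) (m : ℕ) :
    delannoyF α β α β γ (m + 1) (m + 1)
      = 2 * (β * delannoyF α β α β γ (m + 1) m) + γ * delannoyF α β α β γ m m := by
  rw [delannoyF_succ_succ]; linear_combination -delannoyF_diag_symm α β γ m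

theorem delannoyF_offdiag_succ (α β γ : ℝ) (m : ℕ) :
    (m + 2) * delannoyF α β α β γ (m + 2) (m + 1)
      = (2 * m + 3) * α * delannoyF α β α β γ (m + 1) (m + 1)
        + (m + 1) * γ * delannoyF α β α β γ (m + 1) m := by
  have h := delannoyF_holonomic α β γ (m + 1) m
  have e := delannoyF_succ_succ α β α β γ (m + 1) m
  push_cast at h
  linear_combination (m + 2) * e + h

theorem delannoyF_pos {α β γ : ℝ} (hα : 0 < α) (hβ : 0 < β) (hγ : 0 ≤ γ) (m n : ℕ) :
    0 < delannoyF α β α β γ m n := by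
  rcases m with _ | m
  · rw [delannoyF_zero_left]; positivity
  · exact delannoyF_succ_pos_of_left hα hβ.le hα.le hβ hγ m n

theorem tendsto_zero_of_le_mul_add {u ε : ℕ → ℝ} {θ : ℝ} (hu : ∀ n, 0 ≤ u n) (hθ0 : 0 ≤ θ)
    (hθ : θ < 1) (h : ∀ n, u (n + 1) ≤ θ * u n + ε n) (hε : Tendsto ε atTop (𝓝 0)) :
    Tendsto u atTop (𝓝 0) := by
  rw [Metric.tendsto_atTop]
  intro δ hδ
  have hc : 0 < δ / 2 * (1 - θ) := mul_pos (half_pos hδ) (sub_pos.2 hθ)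
  obtain ⟨N, hN⟩ := eventually_atTop.1 (hε.eventually_lt_const hc)
  have key : ∀ k, u (N + k) ≤ θ ^ k * u N + δ / 2 := by
    intro k
    induction k with
    | zero => simp; linarith
    | succ k ih =>
      have h1 := h (N + k)
      have h2 := hN (N + k) (by omega)
      have h3 := mul_le_mul_of_nonneg_left ih hθ0
      rw [← add_assoc, pow_succ]
      nlinarith
  have hlim : Tendsto (fun k => θ ^ k * u N) atTop (𝓝 (0 * u N)) :=
    (tendsto_pow_atTop_nhds_zero_of_lt_one hθ0 hθ).mul_const _
  rw [zero_mul] at hlim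
  obtain ⟨K, hK⟩ := eventually_atTop.1 (hlim.eventually_lt_const (half_pos hδ))
  refine ⟨N + K, fun n hn => ?_⟩
  obtain ⟨k, rfl⟩ := Nat.exists_eq_add_of_le (show N ≤ n by omega)
  have h1 := key k
  have h2 := hK k (by omega)
  rw [Real.dist_eq, sub_zero, abs_of_nonneg (hu _)]
  linarith

/-- `β D_{m+1,m} / D_{m,m}` tends to the positive root `T` of `T² = 2αβT + αβγ`. -/
theorem tendsto_offdiag_div_diag {α β γ T : ℝ} (hα : 0 < α) (hβ : 0 < β) (hγ : 0 ≤ γ)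
    (hT0 : α * β < T) (hT : T ^ 2 = 2 * (α * β) * T + α * β * γ) :
    Tendsto (fun m : ℕ => β * delannoyF α β α β γ (m + 1) m / delannoyF α β α β γ m m)
      atTop (𝓝 T) := by
  set t : ℕ → ℝ := fun m => β * delannoyF α β α β γ (m + 1) m / delannoyF α β α β γ m m with ht
  have hp : 0 < α * β := by positivity
  have hTpos : 0 < T := hp.trans hT0
  have htpos : ∀ m, 0 < t m := fun m => by
    have h1 := delannoyF_pos hα hβ hγ (m + 1) m
    have h2 := delannoyF_pos hα hβ hγ m m
    simp only [ht]; positivity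
  have hstep : ∀ m : ℕ, (m + 2) * t (m + 1)
      = (2 * m + 3) * (α * β) + (m + 1) * (γ * t m / (2 * t m + γ)) := by
    intro m
    have h1 := delannoyF_pos hα hβ hγ (m + 1) m
    have h2 := delannoyF_pos hα hβ hγ m m
    have h3 := delannoyF_pos hα hβ hγ (m + 1) (m + 1)
    have e1 := delannoyF_offdiag_succ α β γ m
    have e2 := delannoyF_diag_succ α β γ m
    have hq : γ * t m / (2 * t m + γ)
        = γ * (β * delannoyF α β α β γ (m + 1) m) / delannoyF α β α β γ (m + 1) (m + 1) := by
      rw [e2]; simp only [ht]; field_simp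
    rw [hq]
    simp only [ht]
    field_simp
    linear_combination e1
  have hTfix : T = 2 * (α * β) + γ * T / (2 * T + γ) := by
    have : 2 * T + γ ≠ 0 := by positivity
    field_simp
    linear_combination 2 * hT
  have hθ : γ / (2 * T + γ) < 1 := by rw [div_lt_one (by positivity)]; linarith
  have hlim : Tendsto (fun m => |t m - T|) atTop (𝓝 0) := by
    refine tendsto_zero_of_le_mul_add (θ := γ / (2 * T + γ))
      (ε := fun m : ℕ => (α * β + γ) / ((m : ℝ) + 2)) (fun _ => abs_nonneg _) (by positivity) hθ
      (fun m => ?_) ?_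
    -- Subtracting the fixed-point equation `hTfix` shows a contraction towards `T` up to an error
    -- of order `1 / (m + 2)`.
    · have htm := htpos m
      have hd : t (m + 1) - T = γ / (2 * t m + γ) * (γ / (2 * T + γ) * (t m - T))
          - (α * β + γ * t m / (2 * t m + γ)) / (m + 2) := by
        have hm : (m : ℝ) + 2 ≠ 0 := by positivity
        have h1 : t (m + 1) = ((2 * m + 3) * (α * β) + (m + 1) * (γ * t m / (2 * t m + γ)))
            / (m + 2) := by rw [← hstep m]; field_simp
        have hd1 : 2 * T + γ ≠ 0 := by positivity
        have hd2 : 2 * t m + γ ≠ 0 := by positivity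
        rw [h1]
        nth_rewrite 1 [hTfix]
        field_simp
        ring
      have hb : γ / (2 * t m + γ) ≤ 1 := by rw [div_le_one (by positivity)]; linarith
      have hb' : γ * t m / (2 * t m + γ) ≤ γ := by
        rw [div_le_iff₀ (by positivity)]; nlinarith [mul_nonneg hγ htm.le]
      have hm : (0 : ℝ) < m + 2 := by positivity
      rw [hd]
      refine (abs_sub _ _).trans (add_le_add ?_ ?_)
      · rw [abs_mul, abs_mul, abs_of_nonneg (show 0 ≤ γ / (2 * t m + γ) by positivity),
          abs_of_nonneg (show 0 ≤ γ / (2 * T + γ) by positivity)]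
        exact mul_le_of_le_one_left (by positivity) hb
      · rw [abs_of_nonneg (by positivity)]
        gcongr
    · exact tendsto_const_nhds.div_atTop
        (tendsto_atTop_add_const_right _ _ tendsto_natCast_atTop_atTop)
  exact tendsto_iff_dist_tendsto_zero.2 (by simpa [Real.dist_eq] using hlim)

theorem tendsto_diag_ratio {α β γ T : ℝ} (hα : 0 < α) (hβ : 0 < β) (hγ : 0 ≤ γ)
    (hT0 : α * β < T) (hT : T ^ 2 = 2 * (α * β) * T + α * β * γ) :
    Tendsto (fun m : ℕ => delannoyF α β α β γ (m + 1) (m + 1) / delannoyF α β α β γ m m)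
      atTop (𝓝 (2 * T + γ)) := by
  refine (((tendsto_offdiag_div_diag hα hβ hγ hT0 hT).const_mul 2).add_const γ).congr fun m => ?_
  have := delannoyF_pos hα hβ hγ m m
  rw [delannoyF_diag_succ]
  field_simp

/-! ### One-sided data: critical and supercritical growth -/

theorem delannoyF_diag_step_ratio {A α β γ T : ℝ} (hα : 0 < α) (hβ : 0 < β) (hγ : 0 ≤ γ)
    (hT0 : α * β < T) (hT : T ^ 2 = 2 * (α * β) * T + α * β * γ) (hA : α < A) :
    ∃ k : ℕ → ℝ, Tendsto k atTop (𝓝 ((A * β - T) * (T - α * β) / (β * (A - α)))) ∧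
      ∀ m, delannoyF A β α β γ (m + 1) (m + 1)
        = A * ((A * β + γ) / (A - α)) * delannoyF A β α β γ m m
          + k m * delannoyF α β α β γ m m := by
  have hA' : A - α ≠ 0 := by linarith
  refine ⟨fun m => β * delannoyF α β α β γ (m + 1) m / delannoyF α β α β γ m m
    - α * (A * β + γ) / (A - α), ?_, fun m => ?_⟩
  · convert (tendsto_offdiag_div_diag hα hβ hγ hT0 hT).sub_const (α * (A * β + γ) / (A - α))
      using 2
    field_simp
    linear_combination -hT
  · have := (delannoyF_pos hα hβ hγ m m).ne'
    have e := delannoyF_diag_step A α β γ m m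
    field_simp
    linear_combination e

/-- The quadratic equation for `T` completes the square, so the rate is never below `2T + γ` and
involves `A` only through `Aβ`. -/
theorem delannoyF_rate_sub {A α β γ T : ℝ} (hβ : 0 < β)
    (hT : T ^ 2 = 2 * (α * β) * T + α * β * γ) (hA : α < A) :
    A * ((A * β + γ) / (A - α)) = 2 * T + γ + (A * β - T) ^ 2 / (β * (A - α)) := by
  have hA' : A - α ≠ 0 := by linarith
  field_simp
  linear_combination -hT

theorem tendsto_atTop_of_eventually_mul_le {u : ℕ → ℝ} {q : ℝ} (hq : 1 < q)
    (hu : ∀ n, 0 < u n) (h : ∀ᶠ n in atTop, q * u n ≤ u (n + 1)) : Tendsto u atTop atTop := by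
  obtain ⟨N, hN⟩ := eventually_atTop.1 h
  refine (tendsto_add_atTop_iff_nat N).1 ?_
  refine tendsto_atTop_of_geom_le (hu _) hq fun n => ?_
  have := hN (n + N) (by omega)
  rwa [show n + N + 1 = n + 1 + N by omega] at this

theorem delannoyF_diag_le {A α β γ : ℝ} (hα : 0 < α) (hβ : 0 < β) (hγ : 0 ≤ γ) (hA : α ≤ A)
    (m : ℕ) : delannoyF α β α β γ m m ≤ delannoyF A β α β γ m m :=
  delannoyF_mono_left hα.le hA hα.le hβ.le hγ m m

/-- The limit of `k` is positive, so `S_A` eventually gains at least a factor `r > 2T + γ` per step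
and outgrows `D`. -/
theorem tendsto_div_diag_atTop_of_lt {A α β γ T : ℝ} (hα : 0 < α) (hβ : 0 < β) (hγ : 0 ≤ γ)
    (hT0 : α * β < T) (hT : T ^ 2 = 2 * (α * β) * T + α * β * γ) (hA : T < A * β) :
    Tendsto (fun m : ℕ => delannoyF A β α β γ m m / delannoyF α β α β γ m m) atTop atTop := by
  have hαA : α < A := lt_of_mul_lt_mul_right (hT0.trans hA) hβ.le
  have hA' : 0 < A - α := by linarith
  obtain ⟨k, hk, hstep⟩ := delannoyF_diag_step_ratio hα hβ hγ hT0 hT hαA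
  have hd := delannoyF_pos hα hβ hγ
  have hS : ∀ m, 0 < delannoyF A β α β γ m m := fun m =>
    (hd m m).trans_le (delannoyF_diag_le hα hβ hγ hαA.le m)
  have hκ : 0 < (A * β - T) * (T - α * β) / (β * (A - α)) := by
    have h1 : 0 < A * β - T := by linarith
    have h2 : 0 < T - α * β := by linarith
    positivity
  have hr := delannoyF_rate_sub hβ hT hαA
  set r := A * ((A * β + γ) / (A - α)) with hrdef
  have hlr : 2 * T + γ < r := by
    have : 0 < (A * β - T) ^ 2 / (β * (A - α)) := by
      have h1 : 0 < A * β - T := by linarith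
      positivity
    linarith
  obtain ⟨q, hq1, hq2⟩ := exists_between hlr
  have hq0 : 0 < q := by
    have : 0 < α * β := by positivity
    linarith
  refine tendsto_atTop_of_eventually_mul_le (q := r / q) (by rwa [one_lt_div hq0])
    (fun n => div_pos (hS n) (hd n n)) ?_
  filter_upwards [hk.eventually_const_lt hκ,
    (tendsto_diag_ratio hα hβ hγ hT0 hT).eventually_lt_const hq1] with m hm1 hm2
  have h0 := hd m m
  have h1 := hd (m + 1) (m + 1)
  rw [div_lt_iff₀ h0] at hm2
  have h3 : r * delannoyF A β α β γ m m ≤ delannoyF A β α β γ (m + 1) (m + 1) := by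
    rw [hstep]; nlinarith
  have hr0 : 0 < r := by linarith
  calc r / q * (delannoyF A β α β γ m m / delannoyF α β α β γ m m)
      = r * delannoyF A β α β γ m m / (q * delannoyF α β α β γ m m) := by field_simp
    _ ≤ delannoyF A β α β γ (m + 1) (m + 1) / delannoyF α β α β γ (m + 1) (m + 1) := by
      gcongr
      exact (mul_pos hr0 (hS m)).le.trans h3

/-- Growth rate on the diagonal for the initial values `A ^ m` and `β ^ n`, when `T ≤ A β`. -/
theorem tendsto_ratio_of_le {A α β γ T : ℝ} (hα : 0 < α) (hβ : 0 < β) (hγ : 0 ≤ γ)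
    (hT0 : α * β < T) (hT : T ^ 2 = 2 * (α * β) * T + α * β * γ) (hA : T ≤ A * β) :
    Tendsto (fun m : ℕ => delannoyF A β α β γ (m + 1) (m + 1) / delannoyF A β α β γ m m)
      atTop (𝓝 (A * ((A * β + γ) / (A - α)))) := by
  have hαA : α < A := lt_of_mul_lt_mul_right (hT0.trans_le hA) hβ.le
  obtain ⟨k, hk, hstep⟩ := delannoyF_diag_step_ratio hα hβ hγ hT0 hT hαA
  have hd := delannoyF_pos hα hβ hγ
  have hle := delannoyF_diag_le hα hβ hγ hαA.le
  have hS : ∀ m, 0 < delannoyF A β α β γ m m := fun m => (hd m m).trans_le (hle m)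
  have hzero : Tendsto (fun m => k m * (delannoyF α β α β γ m m / delannoyF A β α β γ m m))
      atTop (𝓝 0) := by
    -- At the threshold `k → 0` while `D / S_A ≤ 1`; above it `k` converges while `D / S_A → 0`.
    rcases hA.eq_or_lt with hA | hA
    · have hk0 : Tendsto k atTop (𝓝 0) := by simpa [← hA] using hk
      refine squeeze_zero_norm (fun m => ?_) (tendsto_zero_iff_norm_tendsto_zero.1 hk0)
      rw [norm_mul]
      refine mul_le_of_le_one_right (norm_nonneg _) ?_
      rw [Real.norm_of_nonneg (div_pos (hd m m) (hS m)).le, div_le_one (hS m)]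
      exact hle m
    · have h := (tendsto_div_diag_atTop_of_lt hα hβ hγ hT0 hT hA).inv_tendsto_atTop
      simpa using hk.mul (h.congr fun m => by simp)
  refine ((hzero.const_add (A * ((A * β + γ) / (A - α)))).congr fun m => ?_).trans (by simp)
  have := (hS m).ne'
  rw [hstep]
  field_simp

/-! ### One-sided data: subcritical growth -/

theorem bddAbove_div_diag_of_lt {A α β γ T : ℝ} (hα : 0 < α) (hβ : 0 < β) (hγ : 0 ≤ γ)
    (hT0 : α * β < T) (hT : T ^ 2 = 2 * (α * β) * T + α * β * γ) (hαA : α < A)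
    (hA : A * β < T) :
    ∃ C : ℝ, ∀ m, delannoyF A β α β γ m m ≤ C * delannoyF α β α β γ m m := by
  obtain ⟨k, hk, hstep⟩ := delannoyF_diag_step_ratio hα hβ hγ hT0 hT hαA
  have hd := delannoyF_pos hα hβ hγ
  have hS : ∀ m, 0 < delannoyF A β α β γ m m := fun m =>
    (hd m m).trans_le (delannoyF_diag_le hα hβ hγ hαA.le m)
  have hA' : 0 < A - α := by linarith
  have hr := delannoyF_rate_sub hβ hT hαA
  set r := A * ((A * β + γ) / (A - α)) with hrdef
  have hlr : 2 * T + γ < r := by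
    have : 0 < (A * β - T) ^ 2 / (β * (A - α)) := by
      have h1 : 0 < T - A * β := by linarith
      have h2 : 0 < (A * β - T) ^ 2 := by nlinarith
      positivity
    linarith
  obtain ⟨q, hq, hqr⟩ := exists_between hlr
  obtain ⟨q', hq', hqq'⟩ := exists_between hq
  have hq0 : 0 < q' := by
    have : 0 < α * β := by positivity
    linarith
  -- This `B` is the critical value of `A`: its array dominates that of `A` and has rate exactly `2T
  -- + γ`.
  set B := T / β with hBdef
  have hBβ : B * β = T := by rw [hBdef]; field_simp
  have hAB : A ≤ B := by rw [hBdef, le_div_iff₀ hβ]; exact hA.le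
  have hαB : α < B := hαA.trans_le hAB
  have hU : ∀ m, delannoyF A β α β γ m m ≤ delannoyF B β α β γ m m := fun m =>
    delannoyF_mono_left (hα.trans hαA).le hAB hα.le hβ.le hγ m m
  have hratio := tendsto_ratio_of_le hα hβ hγ hT0 hT hBβ.ge
  rw [delannoyF_rate_sub hβ hT hαB, hBβ] at hratio
  simp only [sub_self, ne_eq, OfNat.ofNat_ne_zero, not_false_eq_true, zero_pow, zero_div,
    add_zero] at hratio
  obtain ⟨c, hc⟩ := hk.bddBelow_range
  have hkc : ∀ m, c ≤ k m := fun m => hc ⟨m, rfl⟩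
  -- Once `S_A ≥ K D`, the forcing costs at most `(r - q) S_A`, leaving growth by the factor `q`.
  set K := |c| / (r - q) with hK
  have hrq : 0 < r - q := by linarith
  have hgrow : ∀ m, K * delannoyF α β α β γ m m ≤ delannoyF A β α β γ m m →
      q * delannoyF A β α β γ m m ≤ delannoyF A β α β γ (m + 1) (m + 1) := by
    intro m hm
    have h1 : |c| * delannoyF α β α β γ m m ≤ (r - q) * delannoyF A β α β γ m m := by
      calc _ = (r - q) * (K * delannoyF α β α β γ m m) := by rw [hK]; field_simp
        _ ≤ _ := by gcongr
    have h2 : -|c| * delannoyF α β α β γ m m ≤ k m * delannoyF α β α β γ m m :=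
      mul_le_mul_of_nonneg_right ((neg_abs_le c).trans (hkc m)) (hd m m).le
    rw [hstep]
    linarith
  -- growth at rate `q` would contradict the rate of the critical initial values
  have hev : ∀ᶠ m in atTop, delannoyF A β α β γ m m ≤ K * delannoyF α β α β γ m m := by
    obtain ⟨N₁, hN₁⟩ := eventually_atTop.1 (hratio.eventually_lt_const hq')
    obtain ⟨N₂, hN₂⟩ := eventually_atTop.1
      ((tendsto_diag_ratio hα hβ hγ hT0 hT).eventually_lt_const hq)
    refine eventually_atTop.2 ⟨max N₁ N₂, fun M hM => ?_⟩
    by_contra! hlt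
    have hall : ∀ n, M ≤ n → K * delannoyF α β α β γ n n ≤ delannoyF A β α β γ n n := by
      intro n hn
      induction n, hn using Nat.le_induction with
      | base => exact hlt.le
      | succ n hn ih =>
        have h1 := hN₂ n (by omega)
        rw [div_lt_iff₀ (hd n n)] at h1
        have hK0 : 0 ≤ K := by positivity
        calc K * delannoyF α β α β γ (n + 1) (n + 1)
            ≤ K * (q * delannoyF α β α β γ n n) := by gcongr
          _ = q * (K * delannoyF α β α β γ n n) := by ring
          _ ≤ q * delannoyF A β α β γ n n :=
            mul_le_mul_of_nonneg_left ih (hq0.trans hqq').le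
          _ ≤ _ := hgrow n ih
    have htop : Tendsto (fun m => delannoyF A β α β γ m m / delannoyF B β α β γ m m)
        atTop atTop := by
      refine tendsto_atTop_of_eventually_mul_le (q := q / q') (by rwa [one_lt_div hq0])
        (fun n => div_pos (hS n) ((hS n).trans_le (hU n))) ?_
      filter_upwards [eventually_ge_atTop M] with n hn
      have h1 := hN₁ n (by omega)
      have hB0 := (hS n).trans_le (hU n)
      have hB1 := (hS (n + 1)).trans_le (hU (n + 1))
      rw [div_lt_iff₀ hB0] at h1
      have h2 := hgrow n (hall n hn)
      have h3 := hS (n + 1)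
      calc q / q' * (delannoyF A β α β γ n n / delannoyF B β α β γ n n)
          = q * delannoyF A β α β γ n n / (q' * delannoyF B β α β γ n n) := by field_simp
        _ ≤ _ := by gcongr
    obtain ⟨n, hn⟩ := (htop.eventually_gt_atTop 1).exists
    rw [one_lt_div ((hS n).trans_le (hU n))] at hn
    exact absurd (hU n) (not_le.2 hn)
  obtain ⟨N, hN⟩ := eventually_atTop.1 hev
  have hnn : ∀ n, 0 ≤ delannoyF A β α β γ n n / delannoyF α β α β γ n n := fun n =>
    (div_pos (hS n) (hd n n)).le
  refine ⟨K + ∑ n ∈ Finset.range N, delannoyF A β α β γ n n / delannoyF α β α β γ n n,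
    fun m => ?_⟩
  rcases le_or_gt N m with hm | hm
  · refine (hN m hm).trans (mul_le_mul_of_nonneg_right ?_ (hd m m).le)
    have := Finset.sum_nonneg fun n (_ : n ∈ Finset.range N) => hnn n
    linarith
  · rw [← div_le_iff₀ (hd m m)]
    have := Finset.single_le_sum (fun n _ => hnn n) (Finset.mem_range.2 hm)
    have hK0 : 0 ≤ K := by positivity
    linarith

theorem tendsto_diag_add_ratio {α β γ T : ℝ} (hα : 0 < α) (hβ : 0 < β) (hγ : 0 ≤ γ)
    (hT0 : α * β < T) (hT : T ^ 2 = 2 * (α * β) * T + α * β * γ) (j : ℕ) :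
    Tendsto (fun m : ℕ => delannoyF α β α β γ (m + j) (m + j) / delannoyF α β α β γ m m)
      atTop (𝓝 ((2 * T + γ) ^ j)) := by
  have hd := delannoyF_pos hα hβ hγ
  induction j with
  | zero => exact tendsto_const_nhds.congr fun m => by simp [(hd m m).ne']
  | succ j ih =>
    have h := (tendsto_add_atTop_iff_nat j).2 (tendsto_diag_ratio hα hβ hγ hT0 hT)
    rw [pow_succ]
    refine (ih.mul h).congr fun m => ?_
    have h1 := (hd m m).ne'
    have h2 := (hd (m + j) (m + j)).ne'
    field_simp
    rfl

/-- The recurrence, solved for its `α`-term, expresses each off-diagonal through the two nearer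
ones; the equation for `T` makes powers of `T / α` compatible with it. -/
theorem tendsto_shifted_diag {α β γ T : ℝ} (hα : 0 < α) (hβ : 0 < β) (hγ : 0 ≤ γ)
    (hT0 : α * β < T) (hT : T ^ 2 = 2 * (α * β) * T + α * β * γ) (j : ℕ) :
    Tendsto (fun m : ℕ => delannoyF α β α β γ m (m + j) / delannoyF α β α β γ m m)
      atTop (𝓝 ((T / α) ^ j)) := by
  have hd := delannoyF_pos hα hβ hγ
  induction j using Nat.twoStepInduction with
  | zero => exact tendsto_const_nhds.congr fun m => by simp [(hd m m).ne']
  | one =>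
    rw [pow_one]
    refine ((tendsto_offdiag_div_diag hα hβ hγ hT0 hT).div_const α).congr fun m => ?_
    rw [delannoyF_diag_symm]
    field_simp
  | more j ih1 ih2 =>
    have hlam := tendsto_diag_ratio hα hβ hγ hT0 hT
    have h1 := ((tendsto_add_atTop_iff_nat 1).2 ih1).mul hlam
    have h2 := ((tendsto_add_atTop_iff_nat 1).2 ih2).mul hlam
    have h := ((h2.sub (h1.const_mul β)).sub (ih2.const_mul γ)).div_const α
    have hval : (T / α) ^ (j + 2) = ((T / α) ^ (j + 1) * (2 * T + γ)
        - β * ((T / α) ^ j * (2 * T + γ)) - γ * (T / α) ^ (j + 1)) / α := by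
      rw [pow_add, pow_add]
      generalize (T / α) ^ j = x
      field_simp
      linear_combination -x * hT
    rw [hval]
    refine h.congr fun m => ?_
    have e := delannoyF_succ_succ α β α β γ m (m + (j + 1))
    have hm := (hd m m).ne'
    have hm1 := (hd (m + 1) (m + 1)).ne'
    rw [show m + 1 + (j + 1) = m + (j + 1) + 1 by omega, show m + 1 + j = m + (j + 1) by omega,
      show m + (j + 2) = m + (j + 1) + 1 by omega]
    field_simp
    linear_combination e

theorem tendsto_div_diag_of_lt {A α β γ T : ℝ} (hα : 0 < α) (hβ : 0 < β) (hγ : 0 ≤ γ)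
    (hT0 : α * β < T) (hT : T ^ 2 = 2 * (α * β) * T + α * β * γ) (hA0 : 0 ≤ A)
    (hA : A * β < T) :
    Tendsto (fun m : ℕ => delannoyF A β α β γ m m / delannoyF α β α β γ m m) atTop
      (𝓝 ((T - α * β) / (T - A * β))) := by
  have hd := delannoyF_pos hα hβ hγ
  have hTpos : 0 < T := (by positivity : 0 < α * β).trans hT0
  -- Boundedness at a slightly larger, still subcritical `A'` bounds each term of
  -- `delannoyF_eq_sum`, so the terms for `A` are dominated by a geometric series in `A / A'`.
  obtain ⟨A', hA1, hA2⟩ := exists_between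
    (show max A α < T / β from max_lt (by rwa [lt_div_iff₀ hβ]) (by rwa [lt_div_iff₀ hβ]))
  have hαA' : α < A' := (le_max_right _ _).trans_lt hA1
  have hAA' : A < A' := (le_max_left _ _).trans_lt hA1
  have hA'0 : 0 < A' := hα.trans hαA'
  rw [lt_div_iff₀ hβ] at hA2
  obtain ⟨C, hC⟩ := bddAbove_div_diag_of_lt hα hβ hγ hT0 hT hαA' hA2
  have hq : 0 < A' - α := by linarith
  set g : ℕ → ℕ → ℝ := fun m j =>
    if j < m then A ^ j * (delannoyF α β α β γ (m - 1 - j) m / delannoyF α β α β γ m m) else 0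
    with hg
  have hbound : ∀ m j, ‖g m j‖ ≤ C / (A' - α) * (A / A') ^ j := by
    intro m j
    have hC0 : 0 ≤ C := by
      have := hC 0
      simp only [delannoyF_zero_left, pow_zero, mul_one] at this
      linarith
    simp only [hg]
    split_ifs with hj
    · have h1 := hd (m - 1 - j) m
      have h2 := hd m m
      rw [Real.norm_of_nonneg (by positivity), div_pow]
      have h3 := hC m
      rw [delannoyF_eq_sum] at h3
      have h4 := Finset.single_le_sum
        (f := fun j => A' ^ j * delannoyF α β α β γ (m - 1 - j) m)
        (fun i _ => (mul_pos (pow_pos hA'0 i) (hd (m - 1 - i) m)).le) (Finset.mem_range.2 hj)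
      have h5 := mul_le_mul_of_nonneg_left h4 hq.le
      have h6 : A' ^ j * delannoyF α β α β γ (m - 1 - j) m / delannoyF α β α β γ m m
          ≤ C / (A' - α) := by
        rw [div_le_div_iff₀ h2 hq]
        linarith
      calc A ^ j * (delannoyF α β α β γ (m - 1 - j) m / delannoyF α β α β γ m m)
          = A' ^ j * delannoyF α β α β γ (m - 1 - j) m / delannoyF α β α β γ m m
            * (A ^ j / A' ^ j) := by field_simp
        _ ≤ _ := by gcongr
    · simp only [norm_zero]
      positivity
  have hptw : ∀ j, Tendsto (fun m => g m j) atTop (𝓝 (A ^ j * (β / T) ^ (j + 1))) := by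
    intro j
    refine (tendsto_add_atTop_iff_nat (j + 1)).1 ?_
    have h := ((tendsto_shifted_diag hα hβ hγ hT0 hT (j + 1)).div
      (tendsto_diag_add_ratio hα hβ hγ hT0 hT (j + 1)) (by positivity)).const_mul (A ^ j)
    have hval : (T / α) ^ (j + 1) / (2 * T + γ) ^ (j + 1) = (β / T) ^ (j + 1) := by
      rw [← div_pow]
      congr 1
      field_simp
      linear_combination hT
    rw [hval] at h
    refine h.congr fun m => ?_
    have h1 := (hd m m).ne'
    simp only [hg]
    rw [if_pos (by omega), show m + (j + 1) - 1 - j = m by omega]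
    simp only [Pi.div_apply]
    field_simp
  have hsum : Tendsto (fun m => ∑' j, g m j) atTop (𝓝 (∑' j, A ^ j * (β / T) ^ (j + 1))) := by
    refine tendsto_tsum_of_dominated_convergence
      (bound := fun j => C / (A' - α) * (A / A') ^ j) ?_ hptw (.of_forall fun m => hbound m)
    exact (summable_geometric_of_lt_one (by positivity) (by rwa [div_lt_one hA'0])).mul_left _
  have hgeom : HasSum (fun j => A ^ j * (β / T) ^ (j + 1)) (β / T * (1 - A * β / T)⁻¹) := by
    have h := (hasSum_geometric_of_lt_one (r := A * β / T) (by positivity)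
      (by rwa [div_lt_one hTpos])).mul_left (β / T)
    refine h.congr_fun ?_
    intro j
    rw [mul_div_assoc, mul_pow, pow_succ]; ring
  rw [hgeom.tsum_eq] at hsum
  have hne : T - A * β ≠ 0 := by linarith
  have hne' : T - β * A ≠ 0 := by linarith
  have hval : (T - α * β) / (T - A * β) = 1 + (A - α) * (β / T * (1 - A * β / T)⁻¹) := by
    have : 1 - A * β / T = (T - A * β) / T := by field_simp
    rw [this]
    field_simp
    ring
  rw [hval]
  refine ((hsum.const_mul (A - α)).const_add 1).congr fun m => ?_
  have h1 := (hd m m).ne'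
  rw [tsum_eq_sum (s := Finset.range m) fun j hj => by
      simp only [hg]
      rw [if_neg (by simpa using hj)],
    delannoyF_eq_sum A, add_div, div_self h1, mul_div_assoc, Finset.sum_div]
  congr 2
  refine Finset.sum_congr rfl fun j hj => ?_
  simp only [hg]
  rw [if_pos (by simpa using hj)]
  ring

/-- At the threshold, monotonicity in `A` applies: the subcritical limits `(T - αβ) / (T - Aβ)` blow
up as `Aβ` increases to `T`. -/
theorem tendsto_div_diag_atTop_of_le {A α β γ T : ℝ} (hα : 0 < α) (hβ : 0 < β) (hγ : 0 ≤ γ)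
    (hT0 : α * β < T) (hT : T ^ 2 = 2 * (α * β) * T + α * β * γ) (hA : T ≤ A * β) :
    Tendsto (fun m : ℕ => delannoyF A β α β γ m m / delannoyF α β α β γ m m) atTop atTop := by
  rcases hA.lt_or_eq with hA | hA
  · exact tendsto_div_diag_atTop_of_lt hα hβ hγ hT0 hT hA
  have hd := delannoyF_pos hα hβ hγ
  have hTpos : 0 < T := (by positivity : 0 < α * β).trans hT0
  have hp : 0 < T - α * β := by linarith
  refine tendsto_atTop.2 fun K => ?_
  -- a subcritical `A'` close enough to `A` already gives a limit above `K`
  set δ := min T ((T - α * β) / (|K| + 1)) with hδ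
  have hδ0 : 0 < δ := lt_min hTpos (by positivity)
  have hA' : (T - δ) / β * β = T - δ := by field_simp
  have h0 : 0 ≤ (T - δ) / β := div_nonneg (sub_nonneg.2 (min_le_left _ _)) hβ.le
  have hle : (T - δ) / β ≤ A := by rw [div_le_iff₀ hβ]; linarith
  have h := tendsto_div_diag_of_lt hα hβ hγ hT0 hT h0 (by rw [hA']; linarith)
  rw [hA', sub_sub_cancel] at h
  have hK : K < (T - α * β) / δ := by
    rw [lt_div_iff₀ hδ0]
    have h1 : δ ≤ (T - α * β) / (|K| + 1) := min_le_right _ _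
    rw [le_div_iff₀ (by positivity)] at h1
    nlinarith [mul_le_mul_of_nonneg_right (le_abs_self K) hδ0.le]
  filter_upwards [h.eventually_const_lt hK] with m hm
  refine hm.le.trans ?_
  have := hd m m
  gcongr
  exact delannoyF_mono_left h0 hle hα.le hβ.le hγ m m

/-! ### Combining the two sides -/

/-- With `x = Aβ - T` and `s = T - αβ > 0`, the excess over `2T + γ` is `x² / (x + s)`, increasing
for `x ≥ 0`. -/
theorem delannoyF_rate_lt {A B α β γ T : ℝ} (hα : 0 < α) (hβ : 0 < β)
    (hT0 : α * β < T) (hT : T ^ 2 = 2 * (α * β) * T + α * β * γ) (hA : T ≤ A * β)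
    (hAB : A * β < B * α) :
    A * ((A * β + γ) / (A - α)) < B * ((B * α + γ) / (B - β)) := by
  have hαA : α < A := lt_of_mul_lt_mul_right (hT0.trans_le hA) hβ.le
  have hβB : β < B := lt_of_mul_lt_mul_right (by linarith : β * α < B * α) hα.le
  rw [delannoyF_rate_sub hβ hT hαA,
    delannoyF_rate_sub (α := β) (T := T) hα (by linear_combination hT) hβB]
  have h1 : 0 < A - α := by linarith
  have h2 : 0 < B - β := by linarith
  gcongr 2 * T + γ + ?_
  rw [div_lt_div_iff₀ (by positivity) (by positivity)]
  obtain ⟨x, hx⟩ : ∃ x, x = A * β - T := ⟨_, rfl⟩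
  obtain ⟨y, hy⟩ : ∃ y, y = B * α - T := ⟨_, rfl⟩
  obtain ⟨s, hs⟩ : ∃ s, s = T - α * β := ⟨_, rfl⟩
  have hx0 : 0 ≤ x := by linarith
  have hxy : x < y := by linarith
  have hs0 : 0 < s := by linarith
  rw [show α * (B - β) = y + s by rw [hy, hs]; ring, show β * (A - α) = x + s by rw [hx, hs]; ring,
    ← hx, ← hy]
  have h3 : 0 < (y - x) * (x * y + s * (x + y)) := by
    have : 0 < y := by linarith
    have : 0 < y - x := by linarith
    positivity
  linarith

/-- The diagonal depends on `A, α, β` only through `A β` and `α β`. -/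
theorem delannoyF_diag_eq_of_mul_eq {A B α β γ : ℝ} (hα : 0 < α) (hβ : 0 < β)
    (hA : α < A) (hAB : A * β = B * α) (m : ℕ) :
    delannoyF A β α β γ m m = delannoyF B α β α γ m m := by
  induction m with
  | zero => simp only [delannoyF_zero_left, pow_zero]
  | succ m ih =>
    -- Multiplied by `β` and `α` respectively, the two diagonal recurrences coincide; their forcing
    -- terms agree by `delannoyF_diag_symm`.
    have e1 := delannoyF_diag_step A α β γ m m
    have e2 := delannoyF_diag_step B β α γ m m
    have e3 := delannoyF_diag_symm α β γ m
    rw [delannoyF_swap β α β α γ (m + 1) m, delannoyF_swap β α β α γ m m] at e2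
    rw [delannoyF_swap B α β α γ m m] at ih e2
    have h : β * (A - α) ≠ 0 := mul_ne_zero hβ.ne' (by linarith)
    apply mul_left_cancel₀ h
    have hB : B = A * β / α := by field_simp; linarith
    subst hB
    have h' : A * β / α * α = A * β := by field_simp
    rw [h', ← ih] at e2
    have e4 : α * (A * β / α - β) = β * (A - α) := by field_simp
    linear_combination β * e1 - α * e2 + β * (A - α) * e3
      + e4 * delannoyF (A * β / α) α β α γ (m + 1) (m + 1)
      - e4 * (α * delannoyF α β α β γ m (m + 1))
      - h' * (A * β + γ) * delannoyF A β α β γ m m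

theorem tendsto_ratio_of_tendsto_div {f S : ℕ → ℝ} {c r : ℝ} (hc : c ≠ 0) (hf : ∀ m, f m ≠ 0)
    (hS : ∀ m, S m ≠ 0) (h : Tendsto (fun m => f m / S m) atTop (𝓝 c))
    (hr : Tendsto (fun m => S (m + 1) / S m) atTop (𝓝 r)) :
    Tendsto (fun m => f (m + 1) / f m) atTop (𝓝 r) := by
  have h1 := ((((tendsto_add_atTop_iff_nat 1).2 h).div h hc).mul hr)
  rw [div_self hc, one_mul] at h1
  refine h1.congr fun m => ?_
  have h2 := hf m
  have h3 := hS m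
  have h4 := hS (m + 1)
  simp only [Pi.div_apply]
  field_simp

theorem delannoyF_diag_superposition (A B α β γ : ℝ) (m : ℕ) :
    delannoyF A B α β γ m m = delannoyF A β α β γ m m + delannoyF B α β α γ m m
      - delannoyF α β α β γ m m := by
  rw [delannoyF_superposition, delannoyF_swap α B]

theorem tendsto_ratio_of_subcritical {A B α β γ T : ℝ} (hA : 0 ≤ A) (hB : 0 ≤ B) (hα : 0 < α)
    (hβ : 0 < β) (hγ : 0 ≤ γ) (hpos : 0 < A * β + B * α + γ)
    (hT0 : α * β < T) (hT : T ^ 2 = 2 * (α * β) * T + α * β * γ)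
    (hf : ∀ m, delannoyF A B α β γ m m ≠ 0) (hAT : A * β < T) (hBT : B * α < T) :
    Tendsto (fun m : ℕ => delannoyF A B α β γ (m + 1) (m + 1) / delannoyF A B α β γ m m)
      atTop (𝓝 (2 * T + γ)) := by
  have hd := delannoyF_pos hα hβ hγ
  have h1 := tendsto_div_diag_of_lt hα hβ hγ hT0 hT hA hAT
  have h2 := tendsto_div_diag_of_lt (T := T) hβ hα hγ (by linarith) (by linear_combination hT)
    hB hBT
  refine tendsto_ratio_of_tendsto_div
    (c := (T - α * β) / (T - A * β) + (T - β * α) / (T - B * α) - 1) ?_ hf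
    (fun m => (hd m m).ne') (((h1.add h2).sub_const 1).congr fun m => ?_)
    (tendsto_diag_ratio hα hβ hγ hT0 hT)
  · have ha0 : 0 ≤ A * β := by positivity
    have hb0 : 0 ≤ B * α := by positivity
    have hp : 0 < α * β := by positivity
    rw [mul_comm β α]
    generalize A * β = a at *
    generalize B * α = b at *
    generalize α * β = p at *
    have ha : 0 < T - a := by linarith
    have hb : 0 < T - b := by linarith
    -- Numerator of the limit of `f / D`. If `a, b ≤ p`, its positivity comes from `hpos`; otherwise
    -- `(a - p)(b - p) < (T - p)²`.
    have hnum : 0 < p * (γ + a + b) - a * b := by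
      have hsq : p * (γ + a + b) - a * b = (T - p) ^ 2 - (a - p) * (b - p) := by
        linear_combination -hT
      rcases le_or_gt a p with h | h <;> rcases le_or_gt b p with h' | h'
      · have h3 : 0 ≤ a * (p - b) := mul_nonneg ha0 (by linarith)
        have h4 : 0 ≤ b * (p - a) := mul_nonneg hb0 (by linarith)
        have h5 : 0 ≤ p * γ := by positivity
        have h6 : 0 ≤ p * b := by positivity
        have h7 : 0 ≤ p * a := by positivity
        have h8 : 0 < p * (a + b + γ) := by positivity
        nlinarith
      · rw [hsq]; nlinarith [mul_nonneg (sub_nonneg.2 h) (sub_nonneg.2 h'.le)]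
      · rw [hsq]; nlinarith [mul_nonneg (sub_nonneg.2 h') (sub_nonneg.2 h.le)]
      · rw [hsq]; nlinarith [mul_lt_mul'' (show a - p < T - p by linarith)
          (show b - p < T - p by linarith) (by linarith) (by linarith)]
    have : (T - p) / (T - a) + (T - p) / (T - b) - 1
        = (p * (γ + a + b) - a * b) / ((T - a) * (T - b)) := by
      field_simp
      linear_combination hT
    rw [this]
    positivity
  · have := (hd m m).ne'
    rw [delannoyF_diag_superposition A B, delannoyF_swap β α β α]
    field_simp

/-- `S_B` dominates: `D / S_B → 0`, and `S_A / S_B` tends to `0`, or is identically `1` when `Aβ =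
Bα`. Hence `f / S_B` has a limit at least `1`. -/
theorem tendsto_ratio_of_critical_le {A B α β γ T : ℝ} (hA : 0 ≤ A) (hα : 0 < α)
    (hβ : 0 < β) (hγ : 0 ≤ γ) (hT0 : α * β < T) (hT : T ^ 2 = 2 * (α * β) * T + α * β * γ)
    (hf : ∀ m, delannoyF A B α β γ m m ≠ 0) (hAB : A * β ≤ B * α) (hBT : T ≤ B * α) :
    Tendsto (fun m : ℕ => delannoyF A B α β γ (m + 1) (m + 1) / delannoyF A B α β γ m m)
      atTop (𝓝 (B * ((B * α + γ) / (B - β)))) := by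
  have hd := delannoyF_pos hα hβ hγ
  have hT0' : β * α < T := by linarith
  have hT' : T ^ 2 = 2 * (β * α) * T + β * α * γ := by linear_combination hT
  have hβB : β < B := lt_of_mul_lt_mul_right (hT0'.trans_le hBT) hα.le
  have hrB := tendsto_ratio_of_le hβ hα hγ hT0' hT' hBT
  have hSB : ∀ m, 0 < delannoyF B α β α γ m m := fun m =>
    (delannoyF_pos hβ hα hγ m m).trans_le (delannoyF_diag_le hβ hα hγ hβB.le m)
  have hdB : Tendsto (fun m => delannoyF α β α β γ m m / delannoyF B α β α γ m m)
      atTop (𝓝 0) := by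
    refine (tendsto_div_diag_atTop_of_le hβ hα hγ hT0' hT' hBT).inv_tendsto_atTop.congr
      fun m => ?_
    rw [Pi.inv_apply, inv_div, delannoyF_swap β α β α]
  obtain ⟨c, hc, hAc⟩ : ∃ c : ℝ, 0 ≤ c ∧ Tendsto
      (fun m => delannoyF A β α β γ m m / delannoyF B α β α γ m m) atTop (𝓝 c) := by
    rcases lt_or_ge (A * β) T with hAT | hAT
    · refine ⟨0, le_rfl, ?_⟩
      have h := (tendsto_div_diag_of_lt hα hβ hγ hT0 hT hA hAT).mul hdB
      rw [mul_zero] at h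
      refine h.congr fun m => ?_
      have := (hd m m).ne'
      field_simp
    have hαA : α < A := lt_of_mul_lt_mul_right (hT0.trans_le hAT) hβ.le
    have hSA : ∀ m, 0 < delannoyF A β α β γ m m := fun m =>
      (hd m m).trans_le (delannoyF_diag_le hα hβ hγ hαA.le m)
    rcases hAB.lt_or_eq with hAB | hAB
    · refine ⟨0, le_rfl, ?_⟩
      have hrA := tendsto_ratio_of_le hα hβ hγ hT0 hT hAT
      have hlt := delannoyF_rate_lt hα hβ hT0 hT hAT hAB
      have hA0 : 0 < A * ((A * β + γ) / (A - α)) := by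
        have : 0 < A - α := by linarith
        have : 0 < A := by linarith
        positivity
      obtain ⟨q, hq1, hq2⟩ := exists_between ((one_lt_div hA0).2 hlt)
      have htop : Tendsto (fun m => delannoyF B α β α γ m m / delannoyF A β α β γ m m)
          atTop atTop := by
        refine tendsto_atTop_of_eventually_mul_le hq1 (fun n => div_pos (hSB n) (hSA n)) ?_
        filter_upwards [(hrB.div hrA hA0.ne').eventually_const_lt hq2] with m hm
        have h1 := hSA m
        have h2 := hSB m
        have h3 := hSA (m + 1)
        calc q * (delannoyF B α β α γ m m / delannoyF A β α β γ m m)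
            ≤ (delannoyF B α β α γ (m + 1) (m + 1) / delannoyF B α β α γ m m)
              / (delannoyF A β α β γ (m + 1) (m + 1) / delannoyF A β α β γ m m)
              * (delannoyF B α β α γ m m / delannoyF A β α β γ m m) :=
              mul_le_mul_of_nonneg_right hm.le (by positivity)
          _ = _ := by field_simp
      exact htop.inv_tendsto_atTop.congr fun m => by rw [Pi.inv_apply, inv_div]
    · refine ⟨1, zero_le_one, tendsto_const_nhds.congr fun m => ?_⟩
      rw [delannoyF_diag_eq_of_mul_eq hα hβ hαA hAB, div_self (hSB m).ne']
  refine tendsto_ratio_of_tendsto_div (c := c + 1 - 0) (by linarith) hf (fun m => (hSB m).ne')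
    (((hAc.add_const 1).sub hdB).congr fun m => ?_) hrB
  have := (hSB m).ne'
  rw [delannoyF_diag_superposition A B]
  field_simp

/-! ### Degenerate weights, nonvanishing and the theorem -/

/-- Without `α` the recurrence never decreases `m - n`, so from the diagonal it never meets a
positive power of `B`. -/
theorem delannoyF_zero_alpha (A B β γ : ℝ) (k n : ℕ) :
    delannoyF A B 0 β γ (n + k) n = A ^ k * (A * β + γ) ^ n := by
  induction n generalizing k with
  | zero => simp [delannoyF_zero_right]
  | succ n ih =>
    rw [show n + 1 + k = n + k + 1 by omega, delannoyF_succ_succ, ih, add_assoc n k 1, ih]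
    ring

theorem delannoyF_diag_pos {A B α β γ : ℝ} (hA : 0 ≤ A) (hB : 0 ≤ B) (hα : 0 ≤ α) (hβ : 0 ≤ β)
    (hγ : 0 ≤ γ) (hpos : 0 < A * β + B * α + γ) (m : ℕ) : 0 < delannoyF A B α β γ m m := by
  induction m with
  | zero => simp [delannoyF_zero_left]
  | succ m ih =>
    by_cases h1 : 0 < A ∧ 0 < β
    · exact delannoyF_succ_pos_of_left h1.1 hB hα h1.2 hγ m (m + 1)
    by_cases h2 : 0 < B ∧ 0 < α
    · rw [delannoyF_swap]
      exact delannoyF_succ_pos_of_left h2.1 hA hβ h2.2 hγ m (m + 1)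
    -- Neither axis contributes, so `γ > 0` and the diagonal step alone carries positivity.
    have h3 : A * β = 0 := by
      rcases hA.eq_or_lt with h | h
      · simp [← h]
      · rcases hβ.eq_or_lt with h' | h'
        · simp [← h']
        · exact absurd ⟨h, h'⟩ h1
    have h4 : B * α = 0 := by
      rcases hB.eq_or_lt with h | h
      · simp [← h]
      · rcases hα.eq_or_lt with h' | h'
        · simp [← h']
        · exact absurd ⟨h, h'⟩ h2
    have h5 : 0 < γ := by linarith
    rw [delannoyF_succ_succ]
    have h6 := delannoyF_nonneg hA hB hα hβ hγ m (m + 1)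
    have h7 := delannoyF_nonneg hA hB hα hβ hγ (m + 1) m
    positivity

theorem delannoyThreshold_spec {α β γ : ℝ} (hα : 0 < α) (hβ : 0 < β) (hγ : 0 ≤ γ) :
    α * β < delannoyThreshold α β γ ∧ delannoyThreshold α β γ ^ 2
      = 2 * (α * β) * delannoyThreshold α β γ + α * β * γ ∧
    (√(α * β) + √(α * β + γ)) ^ 2 = 2 * delannoyThreshold α β γ + γ := by
  have hp : 0 < α * β := by positivity
  have h1 : 0 < √(α * β * (α * β + γ)) := Real.sqrt_pos.2 (by positivity)
  have h2 := Real.sq_sqrt (show 0 ≤ α * β * (α * β + γ) by positivity)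
  have h3 := Real.sq_sqrt hp.le
  have h4 := Real.sq_sqrt (show 0 ≤ α * β + γ by positivity)
  have h5 := Real.sqrt_mul hp.le (α * β + γ)
  unfold delannoyThreshold
  refine ⟨by linarith, by linear_combination h2, by linear_combination h3 + h4 - 2 * h5⟩

theorem mainTheorem2 (A B α β γ : ℝ) (hA : 0 ≤ A) (hB : 0 ≤ B) (hα : 0 ≤ α) (hβ : 0 ≤ β)
    (hγ : 0 ≤ γ) (hpos : 0 < A * β + B * α + γ) :
    (∀ m : ℕ, delannoyF A B α β γ m m ≠ 0) ∧
    ∃ L : ℝ,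
      Tendsto (fun m : ℕ => delannoyF A B α β γ (m + 1) (m + 1) / delannoyF A B α β γ m m)
        atTop (𝓝 L) ∧
      -- the generic case: neither `A = α = 0` nor `B = β = 0`
      (¬ (A = 0 ∧ α = 0) → ¬ (B = 0 ∧ β = 0) →
        (A * β < delannoyThreshold α β γ → B * α < delannoyThreshold α β γ →
          L = (Real.sqrt (α * β) + Real.sqrt (α * β + γ)) ^ 2) ∧
        (A * β ≤ delannoyThreshold α β γ → delannoyThreshold α β γ ≤ B * α →
          B - β ≠ 0 ∧ L = B * ((α * B + γ) / (B - β))) ∧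
        (delannoyThreshold α β γ ≤ A * β → A * β < B * α →
          B - β ≠ 0 ∧ L = B * ((α * B + γ) / (B - β))) ∧
        (B * α ≤ delannoyThreshold α β γ → delannoyThreshold α β γ ≤ A * β →
          A - α ≠ 0 ∧ L = A * ((A * β + γ) / (A - α))) ∧
        (delannoyThreshold α β γ ≤ B * α → B * α < A * β →
          A - α ≠ 0 ∧ L = A * ((A * β + γ) / (A - α))) ∧
        (delannoyThreshold α β γ < A * β → A * β = B * α →
          B - β ≠ 0 ∧ L = B * ((α * B + γ) / (B - β)))) ∧
      -- the degenerate case, in which the quotients above may be `0 / 0`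
      ((A = 0 ∧ α = 0) ∨ (B = 0 ∧ β = 0) → L = γ) := by
  have hf : ∀ m : ℕ, delannoyF A B α β γ m m ≠ 0 := fun m =>
    (delannoyF_diag_pos hA hB hα hβ hγ hpos m).ne'
  refine ⟨hf, ?_⟩
  have hAβ : 0 ≤ A * β := by positivity
  have hBα : 0 ≤ B * α := by positivity
  -- For `α = 0` the threshold is `0` and the ratio is constantly `A * β + γ`.
  rcases hα.eq_or_lt with rfl | hα
  · have hT : delannoyThreshold 0 β γ = 0 := by simp [delannoyThreshold]
    have hc : A * β + γ ≠ 0 := by intro h; linarith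
    refine ⟨A * β + γ, tendsto_const_nhds.congr fun m => ?_, fun h1 h2 => ?_, ?_⟩
    · have e := fun n => delannoyF_zero_alpha A B β γ 0 n
      simp only [add_zero, pow_zero, one_mul] at e
      rw [e, e, pow_succ]
      field_simp
    · have hA0 : A ≠ 0 := fun h => h1 ⟨h, rfl⟩
      rw [hT]
      refine ⟨fun h => by linarith, fun h _ => ?_, fun h h' => by linarith, fun _ _ => ?_,
        fun _ _ => ?_, fun h h' => by linarith⟩
      · have hβ0 : β = 0 := (mul_eq_zero.1 (le_antisymm h hAβ)).resolve_left hA0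
        have hB0 : B ≠ 0 := fun h => h2 ⟨h, hβ0⟩
        subst hβ0
        refine ⟨by simpa using hB0, ?_⟩
        field_simp
        ring
      all_goals
        refine ⟨by simpa using hA0, ?_⟩
        field_simp
        ring
    · rintro (⟨h, _⟩ | ⟨_, h⟩) <;> simp [h]
  rcases hβ.eq_or_lt with rfl | hβ
  · have hT : delannoyThreshold α 0 γ = 0 := by simp [delannoyThreshold]
    have hc : B * α + γ ≠ 0 := by intro h; linarith
    refine ⟨B * α + γ, tendsto_const_nhds.congr fun m => ?_, fun h1 h2 => ?_, ?_⟩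
    · have e := fun n => delannoyF_zero_alpha B A α γ 0 n
      simp only [add_zero, pow_zero, one_mul] at e
      rw [delannoyF_swap A B, delannoyF_swap A B, e, e, pow_succ]
      field_simp
    · have hB0 : B ≠ 0 := fun h => h2 ⟨h, rfl⟩
      have hB' : 0 < B * α := mul_pos (lt_of_le_of_ne hB hB0.symm) hα
      rw [hT]
      refine ⟨fun _ h => by linarith, fun _ _ => ?_, fun _ _ => ?_, fun h _ => by linarith,
        fun h h' => by linarith, fun h h' => by linarith⟩
      all_goals
        refine ⟨by simpa using hB0, ?_⟩
        field_simp
        ring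
    · rintro (⟨_, h⟩ | ⟨h, _⟩)
      · exact absurd h hα.ne'
      · simp [h]
  obtain ⟨hT0, hT, hTL⟩ := delannoyThreshold_spec hα hβ hγ
  rw [hTL]
  set T := delannoyThreshold α β γ
  have hfB := fun h1 h2 => tendsto_ratio_of_critical_le (B := B) hA hα hβ hγ hT0 hT hf h1 h2
  have hfA : B * α ≤ A * β → T ≤ A * β → _ := fun h1 h2 =>
    tendsto_ratio_of_critical_le (B := A) hB hβ hα hγ (by linarith) (by linear_combination hT)
      (fun m => by rw [delannoyF_swap]; exact hf m) h1 h2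
  simp only [delannoyF_swap B A] at hfA
  have hBβ : T ≤ B * α → B - β ≠ 0 := fun h => by
    have : β < B := lt_of_mul_lt_mul_right (by linarith : β * α < B * α) hα.le
    linarith
  have hAα : T ≤ A * β → A - α ≠ 0 := fun h => by
    have : α < A := lt_of_mul_lt_mul_right (hT0.trans_le h) hβ.le
    linarith
  obtain ⟨L, hL⟩ : ∃ L : ℝ, Tendsto (fun m : ℕ =>
      delannoyF A B α β γ (m + 1) (m + 1) / delannoyF A B α β γ m m) atTop (𝓝 L) := by
    rcases lt_or_ge (A * β) T with h1 | h1 <;> rcases lt_or_ge (B * α) T with h2 | h2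
    · exact ⟨_, tendsto_ratio_of_subcritical hA hB hα hβ hγ hpos hT0 hT hf h1 h2⟩
    · exact ⟨_, hfB (h1.le.trans h2) h2⟩
    · exact ⟨_, hfA (h2.le.trans h1) h1⟩
    · rcases le_total (A * β) (B * α) with h | h
      · exact ⟨_, hfB h h2⟩
      · exact ⟨_, hfA h h1⟩
  have hLB : A * β ≤ B * α → T ≤ B * α → B - β ≠ 0 ∧ L = B * ((α * B + γ) / (B - β)) :=
    fun h1 h2 => ⟨hBβ h2, by rw [mul_comm α B]; exact tendsto_nhds_unique hL (hfB h1 h2)⟩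
  have hLA : B * α ≤ A * β → T ≤ A * β → A - α ≠ 0 ∧ L = A * ((A * β + γ) / (A - α)) :=
    fun h1 h2 => ⟨hAα h2, tendsto_nhds_unique hL (hfA h1 h2)⟩
  refine ⟨L, hL, fun _ _ => ⟨fun h1 h2 => tendsto_nhds_unique hL
    (tendsto_ratio_of_subcritical hA hB hα hβ hγ hpos hT0 hT hf h1 h2),
    fun h1 h2 => hLB (h1.trans h2) h2, fun h1 h2 => hLB h2.le (h1.trans h2.le),
    fun h1 h2 => hLA (h1.trans h2) h2, fun h1 h2 => hLA h2.le (h1.trans h2.le),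
    fun h1 h2 => hLB h2.le (h2 ▸ h1.le)⟩, ?_⟩
  rintro (⟨_, h⟩ | ⟨_, h⟩)
  · exact absurd h hα.ne'
  · exact absurd h hβ.ne'
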